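/- Let $\mathbb D=\{z\in\mathbb C:|z|<1\}$ and let $K\subset\mathbb D$ be a nonempty closed subset of $\mathbb C$; put $r=\max\{|z|:z\in K\}$. For a bounded non-negative measure $\mu$ on the unit circle let $$c_k(\mu)=\frac1{2\pi}\int_{-\pi}^{\pi}e^{-ik\theta}\,d\mu(\theta)\quad(k\ge 0),\qquad P[d\mu](z)=\frac1{2\pi}\int_{-\pi}^{\pi}\frac{1-|z|^2}{|e^{i\theta}-z|^2}\,d\mu(\theta)\quad(z\in\mathbb D).$$ Let $n\ge 0$ and let ${\bf c}_{0:n}=(c_0,c_1,\dots,c_n)\in\mathbb C^{n+1}$ be a non-negative covariance sequence, i.e. the Toeplitz matrix $T_n=(c_{i-j})_{i,j=0}^n$, with $c_{-k}:=\bar c_k$, is Hermitian positive semidefinite. Let $\mathcal F_{{\bf c}_{0:n}}$ be the set of all bounded non-negative measures $\mu$ on the unit circle with $c_k(\mu)=c_k$ for $k=0,\dots,n$, and let $$\rho_{\delta_K}(\mathcal F_{{\bf c}_{0:n}})=\sup\{\delta_K(\mu_0,\mu_1):\mu_0,\mu_1\in\mathcal F_{{\bf c}_{0:n}}\},\qquad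 \delta_K(\mu_0,\mu_1)=\max_{z\in K}\bigl|P[d\mu_0](z)-P[d\mu_1](z)\bigr|,$$ be its diameter. Then $$\rho_{\delta_K}(\mathcal F_{{\bf c}_{0:n}})\le\frac{4c_0r^{n+1}}{1-r^2}.$$ Moreover, if $K\ne\{0\}$, then equality holds if and only if ${\bf c}_{0:n}=(c_0,\,c_0\bar\alpha,\,c_0\bar\alpha^2,\dots,\,c_0\bar\alpha^n)$ for some $\alpha\in K$ with $|\alpha|=r$. -/

import Mathlib

open scoped ComplexOrder ComplexConjugate ENNReal

noncomputable section

/-- The unit circle carries its Borel σ-algebra. -/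
instance instMeasurableSpaceCircle : MeasurableSpace Circle := borel Circle

instance instBorelSpaceCircle : BorelSpace Circle := ⟨rfl⟩

/-- The `k`-th covariance `(2π)⁻¹ ∫ e^{-ikθ} dμ(θ)` of a power spectrum, that is, of a bounded
non-negative (Borel) measure `μ` on the unit circle; the variable is `ξ = e^{iθ}`. -/
def covariance (μ : MeasureTheory.FiniteMeasure Circle) (k : ℕ) : ℂ :=
  (2 * (Real.pi : ℂ))⁻¹ * ∫ ξ : Circle, ((ξ : ℂ)⁻¹) ^ k ∂(μ : MeasureTheory.Measure Circle)

/-- The Hermitian Toeplitz matrix `T_n` with entries `c_{i-j}`, where `c_{-k}` stands for the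
complex conjugate of `c_k`. -/
def toeplitzMatrix {n : ℕ} (c : Fin (n + 1) → ℂ) : Matrix (Fin (n + 1)) (Fin (n + 1)) ℂ :=
  Matrix.of fun i j => if j ≤ i then c (i - j) else conj (c (j - i))

/-- The uncertainty set of all power spectra whose covariances of orders `0, …, n` are `c`. -/
def uncertaintySet {n : ℕ} (c : Fin (n + 1) → ℂ) : Set (MeasureTheory.FiniteMeasure Circle) :=
  {μ | ∀ k : Fin (n + 1), c k = covariance μ k}

/-- The Poisson integral `P[dμ](z) = (2π)⁻¹ ∫ (1 - |z|²) / |e^{iθ} - z|² dμ(θ)`. -/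
def poissonIntegral (μ : MeasureTheory.FiniteMeasure Circle) (z : ℂ) : ℝ :=
  (2 * Real.pi)⁻¹ * ∫ ξ : Circle, poissonKernel 0 z (ξ : ℂ) ∂(μ : MeasureTheory.Measure Circle)

/-- The distance `δ_K(μ₀, μ₁) = max_{z ∈ K} |P[dμ₀](z) - P[dμ₁](z)|`, with values in `[0, ∞]`
so that the supremum is meaningful for every set `K`. -/
def poissonDist (K : Set ℂ) (μ₀ μ₁ : MeasureTheory.FiniteMeasure Circle) : ℝ≥0∞ :=
  ⨆ z ∈ K, ENNReal.ofReal |poissonIntegral μ₀ z - poissonIntegral μ₁ z|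

/-- The diameter `ρ_{δ_K}(S) = sup {δ_K(μ₀, μ₁) : μ₀, μ₁ ∈ S}` in `[0, ∞]`. -/
def poissonDiam (K : Set ℂ) (S : Set (MeasureTheory.FiniteMeasure Circle)) : ℝ≥0∞ :=
  ⨆ μ₀ ∈ S, ⨆ μ₁ ∈ S, poissonDist K μ₀ μ₁

end

open MeasureTheory

/-! ### Normalised integration as a linear functional -/

namespace MeasureTheory.FiniteMeasure

/-! Put `w = z ξ⁻¹`. The Poisson kernel is `Re (2 / (1 - w) - 1)`, and modulo polynomials of degree
`n` in `w`, whose means depend only on the prescribed covariances, `(1 - |z|²) / (1 - w)` equals `H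
= w ^ n (w - |z|²) / (1 - w)`, of constant modulus `|z| ^ (n + 1)` on the circle. Hence `(1 - |z|²)`
times the difference of the Poisson integrals is twice the difference of the means of `Re H`
(`poissonIntegral_sub_eq`), at most `4 c₀ |z| ^ (n + 1)`; the resulting bound increases with `|z|`.

For sharpness, `H` must be almost `|z| ^ (n + 1)` for one measure and almost its negative for the
other. In `u = ξ⁻¹`, `H` is a multiple of a Blaschke product `b`; the densities `c₀ P Re ((1 + t b)
/ (1 - t b))`, with `P` the Poisson kernel at `conj α`, achieve this as `t → ±1` and keep the
geometric covariances (`exists_geometric_covariance`).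

Conversely, the supremum need not be attained, so near-extremal pairs are used. Testing `H` against
a trigonometric polynomial that clears its denominator gives an approximate recurrence for the
covariances (`norm_covariance_recurrence_le`); compactness of `K` makes it exact at a limit point
`α`. -/

lemma integrable_continuousMap {E : Type*} [NormedAddCommGroup E] (μ : FiniteMeasure Circle)
    (g : C(Circle, E)) : Integrable g (μ : Measure Circle) :=
  g.continuous.integrable_of_hasCompactSupport (.of_compactSpace _)

/-- The normalised integral `(2π)⁻¹ ∫ g dμ` as a linear functional on continuous functions. -/
noncomputable def circleMean (μ : FiniteMeasure Circle) : C(Circle, ℂ) →ₗ[ℂ] ℂ where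
  toFun g := (2 * (Real.pi : ℂ))⁻¹ * ∫ ξ, g ξ ∂(μ : Measure Circle)
  map_add' f g := by
    simp only [ContinuousMap.add_apply]
    rw [integral_add (μ.integrable_continuousMap f) (μ.integrable_continuousMap g), mul_add]
  map_smul' a g := by
    simp only [ContinuousMap.smul_apply, smul_eq_mul, RingHom.id_apply]
    rw [integral_const_mul]
    ring

lemma circleMean_apply (μ : FiniteMeasure Circle) (g : C(Circle, ℂ)) :
    μ.circleMean g = (2 * (Real.pi : ℂ))⁻¹ * ∫ ξ, g ξ ∂(μ : Measure Circle) := rfl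

lemma re_circleMean (μ : FiniteMeasure Circle) (g : C(Circle, ℂ)) :
    (μ.circleMean g).re = (2 * Real.pi)⁻¹ * ∫ ξ, (g ξ).re ∂(μ : Measure Circle) := by
  have h := integral_re (𝕜 := ℂ) (μ.integrable_continuousMap g)
  simp only [RCLike.re_eq_complex_re] at h
  rw [h, circleMean_apply,
    show (2 * (Real.pi : ℂ))⁻¹ = (((2 * Real.pi)⁻¹ : ℝ) : ℂ) by push_cast; rfl,
    Complex.re_ofReal_mul]

lemma norm_circleMean_le (μ : FiniteMeasure Circle) {g h : C(Circle, ℂ)}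
    (hgh : ∀ ξ, ‖g ξ‖ ≤ (h ξ).re) : ‖μ.circleMean g‖ ≤ (μ.circleMean h).re := by
  rw [re_circleMean, circleMean_apply, norm_mul]
  have h2 : ‖(2 * (Real.pi : ℂ))⁻¹‖ = (2 * Real.pi)⁻¹ := by
    rw [norm_inv, norm_mul, Complex.norm_real, Real.norm_of_nonneg Real.pi_pos.le]; simp
  rw [h2]
  refine mul_le_mul_of_nonneg_left ?_ (by positivity)
  exact norm_integral_le_of_norm_le (μ.integrable_continuousMap h).re (.of_forall hgh)

end MeasureTheory.FiniteMeasure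

/-! ### Cauchy kernel and extremal function -/

/-- The function `ξ ↦ ξ⁻¹` on the unit circle. -/
noncomputable def circleInv : C(Circle, ℂ) := ⟨fun ξ => (ξ : ℂ)⁻¹, by
  simp_rw [← Circle.coe_inv]; fun_prop⟩

lemma norm_mul_circle_inv (z : ℂ) (ξ : Circle) : ‖z * (ξ : ℂ)⁻¹‖ = ‖z‖ := by
  rw [norm_mul, norm_inv, Circle.norm_coe, inv_one, mul_one]

lemma one_sub_mul_circle_inv_ne_zero {z : ℂ} (hz : ‖z‖ < 1) (ξ : Circle) :
    1 - z * (ξ : ℂ)⁻¹ ≠ 0 := by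
  intro h
  have h1 := norm_mul_circle_inv z ξ
  rw [← sub_eq_zero.1 h, norm_one] at h1
  exact hz.ne h1.symm

/-- The function `ξ ↦ 1 / (1 - z ξ⁻¹)` on the unit circle. -/
noncomputable def cauchyFun {z : ℂ} (hz : ‖z‖ < 1) : C(Circle, ℂ) :=
  ⟨fun ξ => (1 - z * circleInv ξ)⁻¹,
    Continuous.inv₀ (by fun_prop) (one_sub_mul_circle_inv_ne_zero hz)⟩

lemma one_sub_mul_cauchyFun {z : ℂ} (hz : ‖z‖ < 1) :
    (1 - z • circleInv) * cauchyFun hz = 1 := by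
  ext ξ
  exact mul_inv_cancel₀ (one_sub_mul_circle_inv_ne_zero hz ξ)

/-- The function `w ^ n (w - |z|²) / (1 - w)` of `w = z ξ⁻¹`, which differs from a multiple of
`1 / (1 - w)` by a polynomial of degree `n` in `w`, and has constant modulus. -/
noncomputable def extremalFun (n : ℕ) {z : ℂ} (hz : ‖z‖ < 1) : C(Circle, ℂ) :=
  (z • circleInv) ^ n * (z • circleInv - ((‖z‖ : ℂ) ^ 2) • 1) * cauchyFun hz

lemma extremalFun_apply (n : ℕ) {z : ℂ} (hz : ‖z‖ < 1) (ξ : Circle) :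
    extremalFun n hz ξ =
      (z * (ξ : ℂ)⁻¹) ^ n * (z * (ξ : ℂ)⁻¹ - (‖z‖ : ℂ) ^ 2) * (1 - z * (ξ : ℂ)⁻¹)⁻¹ := by
  simp [extremalFun, cauchyFun, circleInv]

/-- Since `|z| = |w|`, the factor `w - |w|² = w * conj (1 - w)` has modulus `|w| |1 - w|`, which
cancels the denominator. -/
lemma norm_extremalFun (n : ℕ) {z : ℂ} (hz : ‖z‖ < 1) (ξ : Circle) :
    ‖extremalFun n hz ξ‖ = ‖z‖ ^ (n + 1) := by
  have h0 := one_sub_mul_circle_inv_ne_zero hz ξ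
  rw [extremalFun_apply, norm_mul, norm_mul, norm_pow, norm_mul_circle_inv]
  set w := z * (ξ : ℂ)⁻¹ with hw
  have hwz : (‖z‖ : ℂ) ^ 2 = w * conj w := by
    rw [Complex.mul_conj, Complex.normSq_eq_norm_sq, norm_mul_circle_inv]; push_cast; rfl
  have h1 : ‖w - (‖z‖ : ℂ) ^ 2‖ = ‖z‖ * ‖1 - w‖ := by
    rw [hwz, show w - w * conj w = w * conj (1 - w) by simp; ring, norm_mul, Complex.norm_conj,
      norm_mul_circle_inv]
  rw [h1, norm_inv]
  have : ‖1 - w‖ ≠ 0 := norm_ne_zero_iff.2 h0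
  field_simp
  rw [pow_succ]

/-- The numerator `1 - |z|² - w ^ n (w - |z|²)` vanishes at `w = 1`; dividing it by `1 - w` leaves
the two geometric sums. -/
lemma one_sub_norm_sq_smul_cauchyFun (n : ℕ) {z : ℂ} (hz : ‖z‖ < 1) :
    (1 - (‖z‖ : ℂ) ^ 2) • cauchyFun hz = extremalFun n hz +
      ∑ k ∈ Finset.range (n + 1), (z • circleInv) ^ k -
        ((‖z‖ : ℂ) ^ 2) • ∑ k ∈ Finset.range n, (z • circleInv) ^ k := by
  have hq := one_sub_mul_cauchyFun hz
  have hs (m : ℕ) : ∑ k ∈ Finset.range m, (z • circleInv) ^ k =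
      cauchyFun hz - (z • circleInv) ^ m * cauchyFun hz := by
    have h := geom_sum_mul_neg (z • circleInv) m
    calc _ = (∑ k ∈ Finset.range m, (z • circleInv) ^ k) *
        ((1 - z • circleInv) * cauchyFun hz) := by rw [hq, mul_one]
      _ = _ := by rw [← mul_assoc, h, sub_mul, one_mul]
  rw [hs, hs, extremalFun]
  simp only [sub_mul, mul_sub, smul_sub, sub_smul, one_smul, smul_mul_assoc, mul_smul_comm,
    mul_one, pow_succ]
  abel

lemma covariance_eq_circleMean (μ : FiniteMeasure Circle) (k : ℕ) :
    covariance μ k = μ.circleMean (circleInv ^ k) := by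
  rw [covariance, FiniteMeasure.circleMean_apply]
  simp [circleInv]

lemma circleMean_smul_circleInv_pow (μ : FiniteMeasure Circle) (z : ℂ) (k : ℕ) :
    μ.circleMean ((z • circleInv) ^ k) = z ^ k * covariance μ k := by
  rw [smul_pow, map_smul, smul_eq_mul, covariance_eq_circleMean]

lemma circleMean_one (μ : FiniteMeasure Circle) : μ.circleMean 1 = covariance μ 0 := by
  rw [covariance_eq_circleMean, pow_zero]

lemma circleMean_conj (μ : FiniteMeasure Circle) {f g : C(Circle, ℂ)}
    (h : ∀ ξ, g ξ = conj (f ξ)) : μ.circleMean g = conj (μ.circleMean f) := by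
  simp only [FiniteMeasure.circleMean_apply, h, map_mul, ← integral_conj, map_inv₀,
    Complex.conj_ofReal, map_ofNat]

lemma poissonIntegral_eq_re_circleMean (μ : FiniteMeasure Circle) {z : ℂ} (hz : ‖z‖ < 1) :
    poissonIntegral μ z = 2 * (μ.circleMean (cauchyFun hz)).re - (covariance μ 0).re := by
  have h : poissonIntegral μ z = (μ.circleMean ((2 : ℂ) • cauchyFun hz - 1)).re := by
    rw [poissonIntegral, FiniteMeasure.re_circleMean]
    congr 2
    ext ξ
    rw [poissonKernel_eq_re_herglotzRieszKernel, Function.comp_apply, herglotzRieszKernel_def]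
    congr 1
    have h0 := one_sub_mul_circle_inv_ne_zero hz ξ
    have h1 : (ξ : ℂ) ≠ 0 := ξ.coe_ne_zero
    have h2 : (ξ : ℂ) - z ≠ 0 := by
      contrapose! h0
      rw [← sub_eq_zero.1 h0, mul_inv_cancel₀ h1, sub_self]
    simp only [sub_zero, ContinuousMap.sub_apply, ContinuousMap.smul_apply, smul_eq_mul,
      ContinuousMap.one_apply, cauchyFun, circleInv, ContinuousMap.coe_mk]
    field_simp
    ring
  rw [h, map_sub, map_smul, circleMean_one]
  simp

/-! ### Upper bound and stability of near-extremal pairs -/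

section

variable {n : ℕ} {μ₀ μ₁ : FiniteMeasure Circle}

/-- The difference of two Poisson integrals with the same low-order covariances. -/
lemma poissonIntegral_sub_eq (h : ∀ k ≤ n, covariance μ₀ k = covariance μ₁ k) {z : ℂ}
    (hz : ‖z‖ < 1) :
    (1 - ‖z‖ ^ 2) * (poissonIntegral μ₀ z - poissonIntegral μ₁ z) =
      2 * ((μ₀.circleMean (extremalFun n hz)).re - (μ₁.circleMean (extremalFun n hz)).re) := by
  have key (μ : FiniteMeasure Circle) := congrArg μ.circleMean (one_sub_norm_sq_smul_cauchyFun n hz)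
  have h0 := key μ₀
  have h1 := key μ₁
  simp only [map_smul, map_add, map_sub, map_sum, circleMean_smul_circleInv_pow] at h0 h1
  rw [Finset.sum_congr rfl fun k hk => by rw [h k (Finset.mem_range_succ_iff.1 hk)],
    Finset.sum_congr (s₁ := Finset.range n) rfl fun k hk => by
      rw [h k (Finset.mem_range.1 hk).le]] at h0
  have h2 : (1 - (‖z‖ : ℂ) ^ 2) * (μ₀.circleMean (cauchyFun hz) - μ₁.circleMean (cauchyFun hz)) =
      μ₀.circleMean (extremalFun n hz) - μ₁.circleMean (extremalFun n hz) := by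
    simp only [smul_eq_mul] at h0 h1
    linear_combination h0 - h1
  have h3 := congrArg Complex.re h2
  rw [show (1 - (‖z‖ : ℂ) ^ 2) = ((1 - ‖z‖ ^ 2 : ℝ) : ℂ) by push_cast; rfl,
    Complex.re_ofReal_mul, Complex.sub_re, Complex.sub_re] at h3
  rw [poissonIntegral_eq_re_circleMean μ₀ hz, poissonIntegral_eq_re_circleMean μ₁ hz,
    h 0 n.zero_le]
  linear_combination 2 * h3

lemma norm_circleMean_extremalFun_le (μ : FiniteMeasure Circle) (n : ℕ) {z : ℂ} (hz : ‖z‖ < 1) :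
    ‖μ.circleMean (extremalFun n hz)‖ ≤ ‖z‖ ^ (n + 1) * (covariance μ 0).re := by
  have := μ.norm_circleMean_le (g := extremalFun n hz) (h := ((‖z‖ ^ (n + 1) : ℝ) : ℂ) • 1)
    (fun ξ => by
      rw [norm_extremalFun, ContinuousMap.smul_apply, ContinuousMap.one_apply, smul_eq_mul,
        mul_one, Complex.ofReal_re])
  rwa [map_smul, smul_eq_mul, Complex.re_ofReal_mul, circleMean_one] at this

lemma abs_poissonIntegral_sub_le (h : ∀ k ≤ n, covariance μ₀ k = covariance μ₁ k) {z : ℂ}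
    (hz : ‖z‖ < 1) :
    (1 - ‖z‖ ^ 2) * |poissonIntegral μ₀ z - poissonIntegral μ₁ z| ≤
      4 * (covariance μ₀ 0).re * ‖z‖ ^ (n + 1) := by
  have hρ : 0 ≤ 1 - ‖z‖ ^ 2 := by nlinarith [norm_nonneg z]
  have e := poissonIntegral_sub_eq h hz
  rw [← abs_of_nonneg hρ, ← abs_mul, e]
  have a0 := (Complex.abs_re_le_norm _).trans (norm_circleMean_extremalFun_le μ₀ n hz)
  have a1 := (Complex.abs_re_le_norm _).trans (norm_circleMean_extremalFun_le μ₁ n hz)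
  rw [← h 0 n.zero_le] at a1
  rw [abs_le] at *
  constructor <;> linarith

/-- If `H` has constant modulus `R` and its mean is nearly extremal, then `H` is close to `R`
in the mean. -/
lemma norm_circleMean_mul_sub_le (μ : FiniteMeasure Circle) {H p : C(Circle, ℂ)} {R s : ℝ}
    (hH : ∀ ξ, ‖H ξ‖ = R) (hR : R ≤ 1) (hp : ∀ ξ, ‖p ξ‖ ≤ 2) (hs : 0 < s) :
    ‖μ.circleMean (p * (H - (R : ℂ) • 1))‖ ≤
      2 * s * (covariance μ 0).re +
        4 / s * (R * (covariance μ 0).re - (μ.circleMean H).re) := by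
  -- The pointwise majorant comes from `x ≤ s + x² / s` with `x = |H - R|`, where `x² = 2 R (R - Re
  -- H) ≤ 2 (R - Re H)`.
  have := μ.norm_circleMean_le (g := p * (H - (R : ℂ) • 1))
    (h := ((2 * s : ℝ) : ℂ) • 1 + ((4 / s : ℝ) : ℂ) • ((R : ℂ) • 1 - H)) (fun ξ => ?_)
  · simpa only [map_add, map_sub, map_smul, smul_eq_mul, circleMean_one, Complex.add_re,
      Complex.sub_re, Complex.re_ofReal_mul] using this
  · have e : ‖H ξ - R‖ ^ 2 = 2 * R * (R - (H ξ).re) := by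
      have h1 := hH ξ
      rw [← Complex.normSq_eq_norm_sq, Complex.normSq_sub, Complex.normSq_eq_norm_sq, h1]
      simp
      ring
    have hn : ‖H ξ - R‖ ≤ s + 2 / s * (R - (H ξ).re) := by
      have hre : 0 ≤ R - (H ξ).re := sub_nonneg.2 ((Complex.re_le_norm _).trans (hH ξ).le)
      have e2 : ‖H ξ - R‖ ^ 2 ≤ 2 * (R - (H ξ).re) := by nlinarith
      have : ‖H ξ - R‖ ≤ s + ‖H ξ - R‖ ^ 2 / s := by
        rw [← sub_nonneg]
        have : s + ‖H ξ - R‖ ^ 2 / s - ‖H ξ - R‖ =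
            ((s - ‖H ξ - R‖ / 2) ^ 2 + 3 / 4 * ‖H ξ - R‖ ^ 2) / s := by
          field_simp
          ring
        rw [this]
        positivity
      calc _ ≤ _ := this
        _ ≤ s + 2 * (R - (H ξ).re) / s := by gcongr
        _ = _ := by ring
    have hl : ‖(p * (H - (R : ℂ) • 1)) ξ‖ ≤ 2 * ‖H ξ - R‖ := by
      simp only [ContinuousMap.mul_apply, ContinuousMap.sub_apply, ContinuousMap.smul_apply,
        ContinuousMap.one_apply, smul_eq_mul, mul_one, norm_mul]
      exact mul_le_mul_of_nonneg_right (hp ξ) (norm_nonneg _)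
    refine hl.trans ?_
    simp only [ContinuousMap.add_apply, ContinuousMap.sub_apply, ContinuousMap.smul_apply,
        ContinuousMap.one_apply, smul_eq_mul, mul_one, Complex.add_re, Complex.re_ofReal_mul,
        Complex.sub_re, Complex.ofReal_re]
    calc _ ≤ 2 * (s + 2 / s * (R - (H ξ).re)) := by gcongr
      _ = _ := by ring

/-- If two Poisson integrals nearly attain the extremal difference at `z`, then the common
covariances are nearly geometric. -/
lemma norm_covariance_recurrence_le (h : ∀ k ≤ n, covariance μ₀ k = covariance μ₁ k) {z : ℂ}
    (hz : ‖z‖ < 1) {m : ℕ} (hm : m < n) {s : ℝ} (hs : 0 < s) :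
    ‖z ^ n * (z * covariance μ₀ (m + 1) - (‖z‖ : ℂ) ^ 2 * covariance μ₀ m)‖ ≤
      2 * s * (covariance μ₀ 0).re + 1 / s * (4 * ‖z‖ ^ (n + 1) * (covariance μ₀ 0).re -
        (1 - ‖z‖ ^ 2) * (poissonIntegral μ₀ z - poissonIntegral μ₁ z)) := by
  set R : ℝ := ‖z‖ ^ (n + 1) with hR
  have hR1 : R ≤ 1 := pow_le_one₀ (norm_nonneg _) hz.le
  obtain ⟨v, hv⟩ : ∃ v : C(Circle, ℂ), ∀ ξ, v ξ = ξ :=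
    ⟨⟨fun ξ => (ξ : ℂ), by fun_prop⟩, fun _ => rfl⟩
  have hve : circleInv * v = 1 := by
    ext ξ; simp [circleInv, hv]
  obtain ⟨j, rfl⟩ : ∃ j, n = m + 1 + j := ⟨_, (Nat.add_sub_of_le hm).symm⟩
  -- The factor `1 - z ξ⁻¹` clears the denominator of `H`, and the power of `ξ` lowers `ξ ^ (-n)` to
  -- `ξ ^ (-m)`, so `p * H` sees only the covariances of orders `m` and `m + 1`.
  set p : C(Circle, ℂ) := v ^ (j + 1) * (1 - z • circleInv) with hp
  have hpn : ∀ ξ, ‖p ξ‖ ≤ 2 := fun ξ => by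
    simp only [hp, hv, ContinuousMap.mul_apply, ContinuousMap.pow_apply, norm_mul, norm_pow,
      Circle.norm_coe, one_pow, one_mul, ContinuousMap.sub_apply,
      ContinuousMap.one_apply, ContinuousMap.smul_apply, smul_eq_mul, circleInv,
      ContinuousMap.coe_mk]
    refine (norm_sub_le _ _).trans ?_
    rw [norm_mul_circle_inv, norm_one]
    linarith
  have A0 := norm_circleMean_mul_sub_le μ₀ (norm_extremalFun (m + 1 + j) hz) hR1 hpn hs
  have A1 := norm_circleMean_mul_sub_le μ₁ (H := -extremalFun (m + 1 + j) hz) (p := p)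
    (fun ξ => by rw [ContinuousMap.neg_apply, norm_neg, norm_extremalFun]) hR1 hpn hs
  have hpH : p * extremalFun (m + 1 + j) hz = z ^ (m + 1 + j) •
      (z • circleInv ^ (m + 1) - ((‖z‖ : ℂ) ^ 2) • circleInv ^ m) := by
    have hq := one_sub_mul_cauchyFun hz
    have e1 : circleInv ^ (m + 1 + j) * v ^ (j + 1) = circleInv ^ m := by
      rw [show m + 1 + j = m + (j + 1) by ring, pow_add, mul_assoc, ← mul_pow, hve, one_pow,
        mul_one]
    calc _ = (v ^ (j + 1) * (z • circleInv) ^ (m + 1 + j) *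
          (z • circleInv - ((‖z‖ : ℂ) ^ 2) • 1)) * ((1 - z • circleInv) * cauchyFun hz) := by
          rw [hp, extremalFun]; ring
      _ = z ^ (m + 1 + j) • (circleInv ^ (m + 1 + j) * v ^ (j + 1) *
          (z • circleInv - ((‖z‖ : ℂ) ^ 2) • 1)) := by
          rw [hq, mul_one, smul_pow, mul_smul_comm, smul_mul_assoc, mul_comm (v ^ _)]
      _ = _ := by
          rw [e1, mul_sub, mul_smul_comm, mul_smul_comm, mul_one, ← pow_succ]
  -- The frequencies of `p` are `j` and `j + 1`, both at most `n`.
  have hpp : μ₀.circleMean p = μ₁.circleMean p := by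
    have hvk (μ : FiniteMeasure Circle) (k : ℕ) :
        μ.circleMean (v ^ k) = conj (covariance μ k) := by
      rw [covariance_eq_circleMean]
      refine circleMean_conj μ fun ξ => ?_
      simp [hv, circleInv, Circle.coe_inv_eq_conj, ← Circle.coe_inv]
    have hpe : p = v ^ (j + 1) - z • v ^ j := by
      rw [hp, mul_sub, mul_one, mul_smul_comm, pow_succ, mul_assoc, mul_comm v, hve, mul_one]
    rw [hpe, map_sub, map_sub, map_smul, map_smul, hvk, hvk, hvk, hvk, h (j + 1) (by omega),
      h j (by omega)]
  have hm0 (μ : FiniteMeasure Circle) : μ.circleMean (p * extremalFun (m + 1 + j) hz) =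
      z ^ (m + 1 + j) * (z * covariance μ (m + 1) - (‖z‖ : ℂ) ^ 2 * covariance μ m) := by
    rw [hpH, map_smul, map_sub, map_smul, map_smul, ← covariance_eq_circleMean,
      ← covariance_eq_circleMean]
    rfl
  -- With opposite signs of `H` for the two measures, subtraction cancels `R` times the mean of `p`
  -- and doubles the mean of `p * H`.
  have hsum : μ₀.circleMean (p * (extremalFun (m + 1 + j) hz - (R : ℂ) • 1)) -
      μ₁.circleMean (p * (-extremalFun (m + 1 + j) hz - (R : ℂ) • 1)) =
      2 * (z ^ (m + 1 + j) *
        (z * covariance μ₀ (m + 1) - (‖z‖ : ℂ) ^ 2 * covariance μ₀ m)) := by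
    simp only [mul_sub p, mul_neg, mul_smul_comm, mul_one, map_sub, map_neg, map_smul, hm0, hpp]
    rw [h (m + 1) (by omega), h m (by omega)]
    ring
  have hn := norm_sub_le (μ₀.circleMean (p * (extremalFun (m + 1 + j) hz - (R : ℂ) • 1)))
    (μ₁.circleMean (p * (-extremalFun (m + 1 + j) hz - (R : ℂ) • 1)))
  rw [hsum, norm_mul, Complex.norm_ofNat] at hn
  have e := poissonIntegral_sub_eq h hz
  rw [e]
  rw [map_neg, Complex.neg_re, ← h 0 (by omega)] at A1
  have hfin : 2 * s * (covariance μ₀ 0).re + 1 / s * (4 * R * (covariance μ₀ 0).re -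
      2 * ((μ₀.circleMean (extremalFun (m + 1 + j) hz)).re -
        (μ₁.circleMean (extremalFun (m + 1 + j) hz)).re)) =
      ((2 * s * (covariance μ₀ 0).re +
        4 / s * (R * (covariance μ₀ 0).re - (μ₀.circleMean (extremalFun (m + 1 + j) hz)).re)) +
      (2 * s * (covariance μ₀ 0).re + 4 / s * (R * (covariance μ₀ 0).re -
        -(μ₁.circleMean (extremalFun (m + 1 + j) hz)).re))) / 2 := by
    ring
  rw [hfin]
  linarith

end

/-! ### Measures with geometric covariances -/

/-- A continuous nonnegative density on the circle, transported by `u ↦ u⁻¹`. -/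
lemma exists_finiteMeasure_circleMean_eq_circleAverage {d : ℂ → ℝ}
    (hd : ContinuousOn d (Metric.sphere 0 1)) (hd0 : ∀ u ∈ Metric.sphere (0 : ℂ) 1, 0 ≤ d u) :
    ∃ μ : FiniteMeasure Circle, ∀ (g : C(Circle, ℂ)) (G : ℂ → ℂ),
      (∀ ξ : Circle, g ξ⁻¹ = G ξ) →
        μ.circleMean g = Real.circleAverage (fun u => (d u : ℂ) * G u) 0 1 := by
  have hmem (θ : ℝ) : circleMap 0 1 θ ∈ Metric.sphere (0 : ℂ) 1 :=
    circleMap_mem_sphere 0 zero_le_one θ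
  have hcont : Continuous fun θ => d (circleMap 0 1 θ) :=
    hd.comp_continuous (by fun_prop) hmem
  have hnn (θ : ℝ) : 0 ≤ d (circleMap 0 1 θ) := hd0 _ (hmem θ)
  set ν : Measure ℝ := (volume.restrict (Set.Ioc 0 (2 * Real.pi))).withDensity
    fun θ => ENNReal.ofReal (d (circleMap 0 1 θ)) with hν
  have hfin : IsFiniteMeasure ν :=
    isFiniteMeasure_withDensity_ofReal
      (hcont.integrableOn_Ioc (a := 0) (b := 2 * Real.pi)).hasFiniteIntegral
  have hexp : Continuous fun θ : ℝ => (Circle.exp θ)⁻¹ := by fun_prop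
  -- Inversion turns the powers of `ξ⁻¹` into powers of `u`, holomorphic in the disc.
  obtain ⟨μ, hμ⟩ : ∃ μ : FiniteMeasure Circle,
      (μ : Measure Circle) = ν.map fun θ => (Circle.exp θ)⁻¹ := ⟨⟨_, inferInstance⟩, rfl⟩
  refine ⟨μ, fun g G hgG => ?_⟩
  rw [FiniteMeasure.circleMean_apply, hμ,
    integral_map hexp.measurable.aemeasurable g.continuous.aestronglyMeasurable, hν,
    integral_withDensity_eq_integral_toReal_smul hcont.measurable.ennreal_ofReal
      (.of_forall fun _ => ENNReal.ofReal_lt_top), Real.circleAverage_def,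
    intervalIntegral.integral_of_le Real.two_pi_pos.le, Complex.real_smul]
  push_cast
  congr 2
  ext θ
  rw [hgG, ENNReal.toReal_ofReal (hnn θ), Complex.real_smul, Circle.coe_exp]
  simp [circleMap]

section

variable {α : ℂ}

lemma one_sub_mul_ne_zero_of_norm_le (hα : ‖α‖ < 1) {u : ℂ} (hu : ‖u‖ ≤ 1) : 1 - α * u ≠ 0 := by
  intro h
  have h1 : ‖α * u‖ < 1 := by
    rw [norm_mul]; nlinarith [norm_nonneg α, norm_nonneg u]
  rw [← sub_eq_zero.1 h, norm_one] at h1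
  exact lt_irrefl _ h1

/-- The Blaschke product with zeros at `0` (of order `n`) and `conj α`, suitably rotated. -/
noncomputable def blaschkeProd (n : ℕ) (α u : ℂ) : ℂ :=
  (α / ‖α‖) ^ (n + 1) * u ^ n * (u - conj α) / (1 - α * u)

lemma norm_sq_one_sub_mul_sub (α u : ℂ) :
    ‖1 - α * u‖ ^ 2 - ‖u - conj α‖ ^ 2 = (1 - ‖α‖ ^ 2) * (1 - ‖u‖ ^ 2) := by
  simp only [← Complex.normSq_eq_norm_sq, Complex.normSq_apply]
  simp
  ring

lemma norm_blaschkeProd_le (n : ℕ) (hα : ‖α‖ < 1) (hα0 : α ≠ 0) {u : ℂ} (hu : ‖u‖ ≤ 1) :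
    ‖blaschkeProd n α u‖ ≤ 1 := by
  have h0 := norm_pos_iff.2 (one_sub_mul_ne_zero_of_norm_le hα hu)
  have h1 : ‖u - conj α‖ ≤ ‖1 - α * u‖ := by
    refine le_of_sq_le_sq ?_ h0.le
    have := norm_sq_one_sub_mul_sub α u
    have : 0 ≤ (1 - ‖α‖ ^ 2) * (1 - ‖u‖ ^ 2) :=
      mul_nonneg (by nlinarith [norm_nonneg α]) (by nlinarith [norm_nonneg u])
    linarith
  have h2 : ‖α / (‖α‖ : ℂ)‖ = 1 := by simp [hα0]
  rw [blaschkeProd, norm_div, norm_mul, norm_mul, norm_pow, norm_pow, h2, one_pow, one_mul,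
    div_le_one h0]
  have := pow_le_one₀ (n := n) (norm_nonneg u) hu
  nlinarith [norm_nonneg (u - conj α)]

lemma norm_blaschkeProd_eq (n : ℕ) (hα : ‖α‖ < 1) (hα0 : α ≠ 0) {u : ℂ} (hu : ‖u‖ = 1) :
    ‖blaschkeProd n α u‖ = 1 := by
  have h0 := norm_pos_iff.2 (one_sub_mul_ne_zero_of_norm_le hα hu.le)
  have h1 : ‖u - conj α‖ = ‖1 - α * u‖ := by
    have := norm_sq_one_sub_mul_sub α u
    rw [hu] at this
    refine (sq_eq_sq₀ (norm_nonneg _) h0.le).1 ?_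
    linarith
  have h2 : ‖α / (‖α‖ : ℂ)‖ = 1 := by simp [hα0]
  rw [blaschkeProd, norm_div, norm_mul, norm_mul, norm_pow, norm_pow, h2, hu, one_pow, one_pow,
    one_mul, one_mul, h1, div_self h0.ne']

lemma blaschkeProd_conj (n : ℕ) (α : ℂ) : blaschkeProd n α (conj α) = 0 := by
  simp [blaschkeProd]

lemma differentiableOn_blaschkeProd (n : ℕ) (hα : ‖α‖ < 1) :
    DifferentiableOn ℂ (blaschkeProd n α) (Metric.closedBall 0 1) := by
  unfold blaschkeProd
  refine DifferentiableOn.div (by fun_prop) (by fun_prop) fun u hu => ?_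
  exact one_sub_mul_ne_zero_of_norm_le hα (by simpa using hu)

/-- On the circle, the Poisson kernel absorbs the zeros of the Blaschke product. -/
lemma poissonKernel_mul_blaschkeProd {n k : ℕ} (hk : k ≤ n) (hα : ‖α‖ < 1) {u : ℂ}
    (hu : ‖u‖ = 1) :
    (poissonKernel 0 (conj α) u : ℂ) * (conj u) ^ k * blaschkeProd n α u =
      u * ((1 - ‖α‖ ^ 2) * (α / ‖α‖) ^ (n + 1) * u ^ (n - k) / (1 - α * u) ^ 2) := by
  obtain ⟨j, rfl⟩ := Nat.exists_eq_add_of_le hk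
  have h0 := one_sub_mul_ne_zero_of_norm_le hα hu.le
  have hu0 : u ≠ 0 := by rintro rfl; simp at hu
  have hcu : u * conj u = 1 := by
    rw [Complex.mul_conj, Complex.normSq_eq_norm_sq, hu]; simp
  have h1 : u - conj α ≠ 0 := by
    intro h
    rw [sub_eq_zero.1 h, Complex.norm_conj] at hu
    exact hα.ne hu
  have hsq : ((‖u - conj α‖ : ℂ)) ^ 2 * u = (u - conj α) * (1 - α * u) := by
    have : ((‖u - conj α‖ : ℂ)) ^ 2 = (u - conj α) * conj (u - conj α) := by
      rw [Complex.mul_conj, Complex.normSq_eq_norm_sq]; push_cast; rfl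
    rw [this]
    simp only [map_sub, Complex.conj_conj]
    linear_combination (u - conj α) * hcu
  have hn : ((‖u - conj α‖ : ℂ)) ^ 2 = (u - conj α) * (1 - α * u) / u := by
    rw [← hsq]; field_simp
  have hP : (poissonKernel 0 (conj α) u : ℂ) =
      (1 - ‖α‖ ^ 2) * u / ((u - conj α) * (1 - α * u)) := by
    rw [poissonKernel_def]
    push_cast
    rw [sub_zero, sub_zero, hn, hu, Complex.norm_conj]
    push_cast
    field_simp
  have hk1 : (conj u) ^ k * u ^ (k + j) = u ^ j := by
    rw [pow_add, ← mul_assoc, ← mul_pow, mul_comm (conj u), hcu, one_pow, one_mul]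
  rw [hP, blaschkeProd, Nat.add_sub_cancel_left, ← hk1]
  field_simp

lemma circleAverage_poissonKernel_mul {w : ℂ} (hw : ‖w‖ < 1) {f : ℂ → ℂ}
    (hf : DifferentiableOn ℂ f (Metric.closedBall 0 1)) :
    Real.circleAverage (fun u => (poissonKernel 0 w u : ℂ) * f u) 0 1 = f w := by
  have h1 : DiffContOnCl ℂ f (Metric.ball 0 1) :=
    DifferentiableOn.diffContOnCl (by rwa [closure_ball _ one_ne_zero])
  have := h1.circleAverage_poissonKernel_smul (w := w) (by simpa using hw)
  rw [← this]
  rfl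

lemma circleAverage_conj (f : ℂ → ℂ) :
    Real.circleAverage (fun u => conj (f u)) 0 1 = conj (Real.circleAverage f 0 1) := by
  simp only [Real.circleAverage_def, Complex.real_smul, map_mul, Complex.conj_ofReal,
    intervalIntegral.integral_of_le Real.two_pi_pos.le, ← integral_conj]

lemma continuousOn_poissonKernel_sphere {w : ℂ} (hw : ‖w‖ < 1) :
    ContinuousOn (poissonKernel 0 w) (Metric.sphere 0 1) := by
  rw [poissonKernel_eq_re_herglotzRieszKernel]
  have := continuousOn_herglotzRieszKernel_sphere (c := 0) (R := 1) (w := w) (by simpa using hw)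
  rw [abs_one] at this
  exact Complex.continuous_re.comp_continuousOn this

lemma poissonKernel_nonneg {w : ℂ} (hw : ‖w‖ < 1) {u : ℂ} (hu : ‖u‖ = 1) :
    0 ≤ poissonKernel 0 w u := by
  rw [poissonKernel_def, sub_zero, sub_zero, hu]
  exact div_nonneg (by nlinarith [norm_nonneg w]) (by positivity)

/-- The power spectrum with density a multiple of `P_α Re ((1 + t b) / (1 - t b))`, for `b` the
Blaschke product: it has geometric covariances up to order `n` and a prescribed mean of the extremal
function. -/
lemma exists_geometric_covariance {a t : ℝ} (n : ℕ) (ha : 0 ≤ a) (ht : |t| < 1)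
    (hα : ‖α‖ < 1) (hα0 : α ≠ 0) :
    ∃ μ : FiniteMeasure Circle, (∀ k ≤ n, covariance μ k = a * (conj α) ^ k) ∧
      μ.circleMean (extremalFun n hα) = a * t * ‖α‖ ^ (n + 1) := by
  set b := blaschkeProd n α with hb
  set P : ℂ → ℝ := poissonKernel 0 (conj α) with hP
  have hβ : ‖conj α‖ < 1 := by rwa [Complex.norm_conj]
  have htb {u : ℂ} (hu : ‖u‖ ≤ 1) : ‖(t : ℂ) * b u‖ < 1 := by
    rw [norm_mul, Complex.norm_real, Real.norm_eq_abs]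
    have := norm_blaschkeProd_le n hα hα0 hu
    nlinarith [abs_nonneg t, norm_nonneg (b u)]
  have hne {u : ℂ} (hu : ‖u‖ ≤ 1) : 1 - (t : ℂ) * b u ≠ 0 := by
    intro h
    have := htb hu
    rw [← sub_eq_zero.1 h, norm_one] at this
    exact lt_irrefl _ this
  set g : ℂ → ℂ := fun u => (1 - t * b u)⁻¹ with hg
  have hbd : DifferentiableOn ℂ b (Metric.closedBall 0 1) := differentiableOn_blaschkeProd n hα
  have hgd : DifferentiableOn ℂ g (Metric.closedBall 0 1) :=
    DifferentiableOn.inv (by fun_prop) fun u hu => hne (by simpa using hu)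
  set f : ℂ → ℝ := fun u => 1 + (2 * t * b u * g u).re with hf
  have hsub : Metric.sphere (0 : ℂ) 1 ⊆ Metric.closedBall 0 1 := Metric.sphere_subset_closedBall
  have hbc := hbd.continuousOn.mono hsub
  have hgc := hgd.continuousOn.mono hsub
  have hPc : ContinuousOn P (Metric.sphere 0 1) := continuousOn_poissonKernel_sphere hβ
  have hPc' : ContinuousOn (fun u => (P u : ℂ)) (Metric.sphere 0 1) :=
    Complex.continuous_ofReal.comp_continuousOn hPc
  have hfc : ContinuousOn f (Metric.sphere 0 1) :=
    continuousOn_const.add (Complex.continuous_re.comp_continuousOn (by fun_prop))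
  have hf0 {u : ℂ} (hu : ‖u‖ = 1) : 0 ≤ f u := by
    have h1 := hne hu.le
    have h2 : (f u : ℝ) = ((1 + t * b u) / (1 - t * b u)).re := by
      rw [hf, hg]
      simp only
      rw [← Complex.one_re, ← Complex.add_re]
      congr 1
      field_simp
      ring
    -- The Poisson kernel at the interior point `t * b u`, evaluated at the boundary point `1`.
    have h3 := congrFun (poissonKernel_eq_re_herglotzRieszKernel (c := 0) (w := t * b u)) 1
    rw [h2]
    rw [Function.comp_apply, herglotzRieszKernel_def, sub_zero, sub_zero] at h3
    rw [← h3]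
    exact poissonKernel_nonneg (htb hu.le) norm_one
  have hfe (u : ℂ) : (f u : ℂ) = 1 + t * (b u * g u) + t * conj (b u * g u) := by
    have : ((2 * t * b u * g u).re : ℂ) = t * (b u * g u + conj (b u * g u)) := by
      rw [Complex.add_conj, show 2 * (t : ℂ) * b u * g u = ((2 * t : ℝ) : ℂ) * (b u * g u) by
        push_cast; ring, Complex.re_ofReal_mul]
      push_cast
      ring
    simp only [hf, Complex.ofReal_add, this]
    push_cast
    ring
  obtain ⟨μ, hμ⟩ := exists_finiteMeasure_circleMean_eq_circleAverage
    (d := fun u => a * P u * f u) (by fun_prop)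
    (fun u hu => by
      have hu : ‖u‖ = 1 := by simpa using hu
      exact mul_nonneg (mul_nonneg ha (poissonKernel_nonneg hβ hu)) (hf0 hu))
  have hint {F : ℂ → ℂ} (hF : ContinuousOn F (Metric.sphere 0 1)) : CircleIntegrable F 0 1 :=
    hF.circleIntegrable zero_le_one
  -- `f` is holomorphic plus antiholomorphic. The Poisson formula evaluates the first part at `conj
  -- α`, where `b = 0`; the second is left as an average.
  have hsplit {F : ℂ → ℂ} (hF : DifferentiableOn ℂ F (Metric.closedBall 0 1)) :
      Real.circleAverage (fun u => ((a * P u * f u : ℝ) : ℂ) * F u) 0 1 =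
        a * (F (conj α) + t * Real.circleAverage
          (fun u => conj ((P u : ℂ) * conj (F u) * (b u * g u))) 0 1) := by
    have hFc := hF.continuousOn.mono hsub
    have hd1 : DifferentiableOn ℂ (fun u => (1 + t * (b u * g u)) * F u)
      (Metric.closedBall 0 1) := by fun_prop
    have e : (fun u => ((a * P u * f u : ℝ) : ℂ) * F u) = (a : ℂ) •
        ((fun u => (P u : ℂ) * ((1 + t * (b u * g u)) * F u)) +
          (t : ℂ) • fun u => conj ((P u : ℂ) * conj (F u) * (b u * g u))) := by
      ext u
      simp only [Pi.smul_apply, Pi.add_apply, smul_eq_mul, map_mul, Complex.conj_conj,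
        Complex.conj_ofReal]
      push_cast
      rw [hfe, map_mul]
      ring
    have hcc : ContinuousOn (fun u => conj ((P u : ℂ) * conj (F u) * (b u * g u)))
        (Metric.sphere 0 1) := by
      refine Complex.continuous_conj.comp_continuousOn ?_
      exact (hPc'.mul (Complex.continuous_conj.comp_continuousOn hFc)).mul (hbc.mul hgc)
    rw [e, Real.circleAverage_smul, Real.circleAverage_add, Real.circleAverage_smul,
      circleAverage_poissonKernel_mul hβ hd1, hb, blaschkeProd_conj]
    · simp
    · exact hint (hPc'.mul (hd1.continuousOn.mono hsub))
    · exact hint (hcc.const_smul (t : ℂ))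
  refine ⟨μ, fun k hk => ?_, ?_⟩
  · rw [covariance_eq_circleMean, hμ (circleInv ^ k) (fun u => u ^ k) (fun ξ => by
      simp [circleInv]), hsplit (by fun_prop), circleAverage_conj]
    -- The factor `u` makes `h` vanish at `0`, so the mean value property kills the antiholomorphic
    -- part.
    set h : ℂ → ℂ := fun u =>
      u * ((1 - ‖α‖ ^ 2) * (α / ‖α‖) ^ (n + 1) * u ^ (n - k) / (1 - α * u) ^ 2) * g u with hh
    have e : Set.EqOn (fun u => (P u : ℂ) * conj (u ^ k) * (b u * g u)) h
        (Metric.sphere 0 |1|) := fun u hu => by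
      have hu : ‖u‖ = 1 := by simpa using hu
      simp only [hh, map_pow]
      rw [← mul_assoc, hP, hb, poissonKernel_mul_blaschkeProd hk hα hu]
    have hhd : DifferentiableOn ℂ h (Metric.closedBall 0 1) := by
      refine DifferentiableOn.mul (DifferentiableOn.mul (by fun_prop)
        (DifferentiableOn.div (by fun_prop) (by fun_prop) fun u hu => ?_)) hgd
      exact pow_ne_zero _ (one_sub_mul_ne_zero_of_norm_le hα (by simpa using hu))
    have hcl : DiffContOnCl ℂ h (Metric.ball 0 |1|) :=
      DifferentiableOn.diffContOnCl (by rwa [abs_one, closure_ball _ one_ne_zero])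
    rw [Real.circleAverage_congr_sphere e, hcl.circleAverage]
    simp [hh]
  · have hn0 : (‖α‖ : ℂ) ≠ 0 := by simpa using hα0
    have hαα : α * conj α = (‖α‖ : ℂ) ^ 2 := by
      rw [Complex.mul_conj, Complex.normSq_eq_norm_sq]; push_cast; rfl
    rw [hμ (extremalFun n hα) (fun u => (‖α‖ : ℂ) ^ (n + 1) * b u) (fun ξ => by
      rw [extremalFun_apply, Circle.coe_inv, inv_inv, hb, blaschkeProd, ← hαα, div_pow]
      field_simp
      ring), hsplit (by fun_prop), circleAverage_conj]
    -- Here `b * conj b = 1` on the circle leaves `P * g`, and `g = 1` at `conj α`.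
    have e : Set.EqOn (fun u => (P u : ℂ) * conj ((‖α‖ : ℂ) ^ (n + 1) * b u) * (b u * g u))
        (fun u => (P u : ℂ) * ((‖α‖ : ℂ) ^ (n + 1) * g u)) (Metric.sphere 0 |1|) := fun u hu => by
      have hu : ‖u‖ = 1 := by simpa using hu
      have hbb : b u * conj (b u) = 1 := by
        rw [Complex.mul_conj, Complex.normSq_eq_norm_sq, hb, norm_blaschkeProd_eq n hα hα0 hu]
        simp
      simp only [map_mul, map_pow, Complex.conj_ofReal]
      linear_combination (P u : ℂ) * (‖α‖ : ℂ) ^ (n + 1) * g u * hbb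
    rw [Real.circleAverage_congr_sphere e, circleAverage_poissonKernel_mul hβ (by fun_prop), hb]
    simp only [hg, hb, blaschkeProd_conj]
    simp
    ring

end

/-! ### Bound and equality case for the diameter -/

section

variable {n : ℕ} {c : Fin (n + 1) → ℂ}

lemma covariance_eq_of_mem_uncertaintySet {μ₀ μ₁ : FiniteMeasure Circle}
    (h₀ : μ₀ ∈ uncertaintySet c) (h₁ : μ₁ ∈ uncertaintySet c) :
    ∀ k ≤ n, covariance μ₀ k = covariance μ₁ k := fun k hk =>
  (h₀ ⟨k, Nat.lt_succ_of_le hk⟩).symm.trans (h₁ ⟨k, Nat.lt_succ_of_le hk⟩)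

lemma toeplitzMatrix_self (i : Fin (n + 1)) : toeplitzMatrix c i i = c 0 := by
  simp [toeplitzMatrix]

lemma toeplitzMatrix_zero_right (i : Fin (n + 1)) : toeplitzMatrix c i 0 = c i := by
  simp [toeplitzMatrix]

lemma zero_le_of_posSemidef_toeplitzMatrix (hc : (toeplitzMatrix c).PosSemidef) : 0 ≤ c 0 := by
  simpa [toeplitzMatrix_self] using hc.diag_nonneg (i := 0)

/-- A nonnegative covariance sequence of vanishing mass is zero. -/
lemma eq_zero_of_posSemidef_toeplitzMatrix (hc : (toeplitzMatrix c).PosSemidef) (h0 : c 0 = 0)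
    (k : Fin (n + 1)) : c k = 0 := by
  have h := hc.dotProduct_mulVec_zero_iff (Pi.single 0 1)
  have h1 : (toeplitzMatrix c).mulVec (Pi.single 0 1) = fun i => c i := by
    ext i
    simp [toeplitzMatrix_zero_right]
  rw [h1] at h
  exact congrFun (h.1 (by rw [Pi.star_single, star_one, single_dotProduct, one_mul, h0])) k

lemma poissonDist_le_poissonDiam {K : Set ℂ} {S : Set (FiniteMeasure Circle)}
    {μ₀ μ₁ : FiniteMeasure Circle} (h₀ : μ₀ ∈ S) (h₁ : μ₁ ∈ S) {z : ℂ} (hz : z ∈ K) :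
    ENNReal.ofReal |poissonIntegral μ₀ z - poissonIntegral μ₁ z| ≤ poissonDiam K S :=
  le_iSup₂_of_le (f := fun μ₀ _ => ⨆ μ₁ ∈ S, poissonDist K μ₀ μ₁) μ₀ h₀ <|
    le_iSup₂_of_le (f := fun μ₁ _ => poissonDist K μ₀ μ₁) μ₁ h₁ <|
      le_iSup₂_of_le (f := fun z _ => ENNReal.ofReal |poissonIntegral μ₀ z - poissonIntegral μ₁ z|)
        z hz le_rfl

lemma exists_lt_of_lt_poissonDiam {K : Set ℂ} {S : Set (FiniteMeasure Circle)} {x : ℝ}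
    (h : ENNReal.ofReal x < poissonDiam K S) :
    ∃ μ₀ ∈ S, ∃ μ₁ ∈ S, ∃ z ∈ K, x < poissonIntegral μ₀ z - poissonIntegral μ₁ z ∧
      0 ≤ poissonIntegral μ₀ z - poissonIntegral μ₁ z := by
  simp only [poissonDiam, poissonDist, lt_iSup_iff] at h
  obtain ⟨μ₀, h₀, μ₁, h₁, z, hz, h⟩ := h
  have h := (ENNReal.ofReal_lt_ofReal_iff').1 h
  rcases le_total 0 (poissonIntegral μ₀ z - poissonIntegral μ₁ z) with h' | h'
  · exact ⟨μ₀, h₀, μ₁, h₁, z, hz, by linarith [abs_of_nonneg h'], h'⟩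
  · exact ⟨μ₁, h₁, μ₀, h₀, z, hz, by linarith [abs_of_nonpos h'], by linarith⟩

/-- The upper bound for the diameter. -/
lemma poissonDiam_uncertaintySet_le (hc : 0 ≤ c 0) {K : Set ℂ} {r : ℝ} (hr0 : 0 ≤ r) (hr1 : r < 1)
    (hr : ∀ z ∈ K, ‖z‖ ≤ r) :
    poissonDiam K (uncertaintySet c) ≤
      ENNReal.ofReal (4 * (c 0).re * r ^ (n + 1) / (1 - r ^ 2)) := by
  refine iSup₂_le fun μ₀ h₀ => iSup₂_le fun μ₁ h₁ => iSup₂_le fun z hz =>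
    ENNReal.ofReal_le_ofReal ?_
  have hzr := hr z hz
  have hb := abs_poissonIntegral_sub_le (covariance_eq_of_mem_uncertaintySet h₀ h₁)
    (hzr.trans_lt hr1)
  have hc0 : covariance μ₀ 0 = c 0 := (h₀ 0).symm
  rw [hc0] at hb
  have hcr : 0 ≤ (c 0).re := (Complex.le_def.1 hc).1
  have h2 : 0 < 1 - r ^ 2 := by nlinarith
  rw [le_div_iff₀ h2, mul_comm]
  calc _ ≤ (1 - ‖z‖ ^ 2) * |poissonIntegral μ₀ z - poissonIntegral μ₁ z| := by gcongr
    _ ≤ _ := hb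
    _ ≤ _ := by gcongr

/-- A geometric covariance sequence attains the upper bound. -/
lemma le_poissonDiam_of_geometric (hc : 0 ≤ c 0) {K : Set ℂ} {α : ℂ} (hαK : α ∈ K)
    (hα1 : ‖α‖ < 1) (hα0 : α ≠ 0) (h : ∀ k : Fin (n + 1), c k = c 0 * conj α ^ (k : ℕ)) :
    ENNReal.ofReal (4 * (c 0).re * ‖α‖ ^ (n + 1) / (1 - ‖α‖ ^ 2)) ≤
      poissonDiam K (uncertaintySet c) := by
  obtain ⟨hcr, hci⟩ := Complex.le_def.1 hc
  have hce : c 0 = ((c 0).re : ℂ) := Complex.ext rfl hci.symm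
  have h2 : 0 < 1 - ‖α‖ ^ 2 := by nlinarith [norm_nonneg α]
  -- The measures for `t` and `-t` reach the fraction `t` of the bound; `t = 1` itself is out of
  -- reach because `1 - t b` then vanishes on the circle.
  have key (t : ℝ) (ht : t ∈ Set.Ioo (0 : ℝ) 1) :
      ENNReal.ofReal (4 * (c 0).re * ‖α‖ ^ (n + 1) / (1 - ‖α‖ ^ 2) * t) ≤
        poissonDiam K (uncertaintySet c) := by
    have hta : |t| < 1 := by rw [abs_of_pos ht.1]; exact ht.2
    obtain ⟨μ₀, m₀, e₀⟩ := exists_geometric_covariance n hcr hta hα1 hα0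
    obtain ⟨μ₁, m₁, e₁⟩ := exists_geometric_covariance n hcr (t := -t) (by rwa [abs_neg]) hα1 hα0
    have hmem (μ : FiniteMeasure Circle)
        (m : ∀ k ≤ n, covariance μ k = ((c 0).re : ℂ) * conj α ^ k) : μ ∈ uncertaintySet c := by
      intro k
      rw [m k (Nat.lt_succ_iff.1 k.2), h, ← hce]
    refine le_trans (ENNReal.ofReal_le_ofReal ?_)
      (poissonDist_le_poissonDiam (hmem μ₀ m₀) (hmem μ₁ m₁) hαK)
    refine le_trans (le_of_eq ?_) (le_abs_self _)
    have e := poissonIntegral_sub_eq (n := n) (μ₀ := μ₀) (μ₁ := μ₁)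
      (fun k hk => (m₀ k hk).trans (m₁ k hk).symm) hα1
    have r₀ : (μ₀.circleMean (extremalFun n hα1)).re = (c 0).re * t * ‖α‖ ^ (n + 1) := by
      rw [e₀]; norm_cast
    have r₁ : (μ₁.circleMean (extremalFun n hα1)).re = (c 0).re * (-t) * ‖α‖ ^ (n + 1) := by
      rw [e₁]; norm_cast
    rw [r₀, r₁] at e
    rw [div_mul_eq_mul_div, div_eq_iff h2.ne']
    linear_combination -e
  have hlim : Filter.Tendsto (fun t : ℝ =>
      ENNReal.ofReal (4 * (c 0).re * ‖α‖ ^ (n + 1) / (1 - ‖α‖ ^ 2) * t))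
      (nhdsWithin 1 (Set.Iio 1))
      (nhds (ENNReal.ofReal (4 * (c 0).re * ‖α‖ ^ (n + 1) / (1 - ‖α‖ ^ 2) * 1))) :=
    ((ENNReal.continuous_ofReal.comp (continuous_const.mul continuous_id)).tendsto _).mono_left
      nhdsWithin_le_nhds
  rw [mul_one] at hlim
  exact le_of_tendsto hlim (Filter.eventually_of_mem (Ioo_mem_nhdsLT zero_lt_one) key)

/-- A positive covariance sequence attaining the upper bound is geometric. -/
lemma geometric_of_le_poissonDiam (hc : 0 < (c 0).re) {K : Set ℂ} (hK : IsCompact K) {r : ℝ}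
    (hr0 : 0 < r) (hr1 : r < 1) (hr : ∀ z ∈ K, ‖z‖ ≤ r)
    (h : ENNReal.ofReal (4 * (c 0).re * r ^ (n + 1) / (1 - r ^ 2)) ≤
      poissonDiam K (uncertaintySet c)) :
    ∃ α ∈ K, ‖α‖ = r ∧ ∀ k : Fin (n + 1), c k = c 0 * conj α ^ (k : ℕ) := by
  have h2 : 0 < 1 - r ^ 2 := by nlinarith
  -- A deficit of `s²` is allowed so that the term `1 / s` times the deficit is of order `s`.
  have near (s : ℝ) (hs : 0 < s) : ∃ z ∈ K,
      4 * (c 0).re * r ^ (n + 1) - s ^ 2 ≤ 4 * (c 0).re * ‖z‖ ^ (n + 1) ∧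
      ∀ (m : ℕ) (hm : m < n), ‖z ^ n * (z * c ⟨m + 1, by omega⟩ -
        (‖z‖ : ℂ) ^ 2 * c ⟨m, by omega⟩)‖ ≤ s * (2 * (c 0).re + 1) := by
    have hB : 0 < 4 * (c 0).re * r ^ (n + 1) / (1 - r ^ 2) := by positivity
    have hlt : ENNReal.ofReal ((4 * (c 0).re * r ^ (n + 1) - s ^ 2) / (1 - r ^ 2)) <
        poissonDiam K (uncertaintySet c) := by
      refine lt_of_lt_of_le ((ENNReal.ofReal_lt_ofReal_iff hB).2 ?_) h
      gcongr
      linarith [pow_pos hs 2]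
    obtain ⟨μ₀, h₀, μ₁, h₁, z, hz, hlt, hD⟩ := exists_lt_of_lt_poissonDiam hlt
    have hcov := covariance_eq_of_mem_uncertaintySet h₀ h₁
    have hzr := hr z hz
    have hz1 := hzr.trans_lt hr1
    have hc0 : covariance μ₀ 0 = c 0 := (h₀ 0).symm
    have hzz : 0 < 1 - ‖z‖ ^ 2 := by nlinarith [norm_nonneg z]
    have hD0 : 4 * (c 0).re * r ^ (n + 1) - s ^ 2 ≤
        (1 - ‖z‖ ^ 2) * (poissonIntegral μ₀ z - poissonIntegral μ₁ z) := by
      rw [div_lt_iff₀ h2] at hlt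
      calc _ ≤ (1 - r ^ 2) * (poissonIntegral μ₀ z - poissonIntegral μ₁ z) := by linarith
        _ ≤ _ := by gcongr
    refine ⟨z, hz, ?_, fun m hm => ?_⟩
    · have := abs_poissonIntegral_sub_le hcov hz1
      rw [hc0, abs_of_nonneg hD] at this
      exact hD0.trans this
    · have := norm_covariance_recurrence_le hcov hz1 hm hs
      rw [hc0, ← h₀ ⟨m + 1, by omega⟩, ← h₀ ⟨m, by omega⟩] at this
      refine this.trans ?_
      have hzp : 4 * ‖z‖ ^ (n + 1) * (c 0).re ≤ 4 * (c 0).re * r ^ (n + 1) := by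
        rw [mul_right_comm]
        gcongr
      calc _ ≤ 2 * s * (c 0).re + 1 / s * s ^ 2 := by gcongr; linarith
        _ = _ := by field_simp
  choose! z hzK hz₁ hz₂ using fun j : ℕ => near (1 / ((j : ℝ) + 1)) Nat.one_div_pos_of_nat
  obtain ⟨α, hαK, φ, hφ, hlim⟩ := hK.tendsto_subseq hzK
  have hs : Filter.Tendsto (fun j => 1 / ((φ j : ℝ) + 1)) Filter.atTop (nhds 0) :=
    (tendsto_one_div_add_atTop_nhds_zero_nat (𝕜 := ℝ)).comp hφ.tendsto_atTop
  have hnorm : ‖α‖ = r := by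
    refine (hr α hαK).antisymm ?_
    have h3 : 4 * (c 0).re * r ^ (n + 1) - 0 ^ 2 ≤ 4 * (c 0).re * ‖α‖ ^ (n + 1) :=
      le_of_tendsto_of_tendsto' (tendsto_const_nhds.sub (hs.pow 2))
        (tendsto_const_nhds.mul (hlim.norm.pow (n + 1))) fun j => hz₁ (φ j)
    have h4 : r ^ (n + 1) ≤ ‖α‖ ^ (n + 1) :=
      le_of_mul_le_mul_left (by linarith) (by positivity : 0 < 4 * (c 0).re)
    exact le_of_pow_le_pow_left₀ n.succ_ne_zero (norm_nonneg _) h4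
  have hα0 : α ≠ 0 := norm_pos_iff.1 (hnorm ▸ hr0)
  have hrec (m : ℕ) (hm : m < n) : c ⟨m + 1, by omega⟩ = conj α * c ⟨m, by omega⟩ := by
    have hF : Continuous fun z : ℂ => ‖z ^ n * (z * c ⟨m + 1, by omega⟩ -
        (‖z‖ : ℂ) ^ 2 * c ⟨m, by omega⟩)‖ := by fun_prop
    have h3 := le_of_tendsto_of_tendsto' ((hF.tendsto α).comp hlim)
      (hs.mul_const (2 * (c 0).re + 1)) fun j => hz₂ (φ j) m hm
    rw [zero_mul, norm_le_zero_iff] at h3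
    have hαα : (‖α‖ : ℂ) ^ 2 = α * conj α := by
      rw [Complex.mul_conj, Complex.normSq_eq_norm_sq]; push_cast; rfl
    have h4 := (mul_eq_zero.1 h3).resolve_left (pow_ne_zero _ hα0)
    rw [hαα] at h4
    exact mul_left_cancel₀ hα0 (by linear_combination h4)
  refine ⟨α, hαK, hnorm, fun k => ?_⟩
  obtain ⟨k, hk⟩ := k
  induction k with
  | zero => simp
  | succ m ih =>
    rw [hrec m (by omega), ih (by omega), pow_succ]
    ring

end

theorem theorem13 (n : ℕ) (c : Fin (n + 1) → ℂ) (hc : (toeplitzMatrix c).PosSemidef)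
    (K : Set ℂ) (hKclosed : IsClosed K) (hKdisc : K ⊆ Metric.ball (0 : ℂ) 1)
    (r : ℝ) (hr : IsGreatest ((fun z : ℂ => ‖z‖) '' K) r) :
    poissonDiam K (uncertaintySet c) ≤
        ENNReal.ofReal (4 * (c 0).re * r ^ (n + 1) / (1 - r ^ 2)) ∧
      (K ≠ {0} →
        (poissonDiam K (uncertaintySet c) =
            ENNReal.ofReal (4 * (c 0).re * r ^ (n + 1) / (1 - r ^ 2)) ↔
          ∃ α ∈ K, ‖α‖ = r ∧ ∀ k : Fin (n + 1), c k = c 0 * (starRingEnd ℂ α) ^ (k : ℕ))) := by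
  have hc0 := zero_le_of_posSemidef_toeplitzMatrix hc
  obtain ⟨hcr, hci⟩ := Complex.le_def.1 hc0
  obtain ⟨⟨z₀, hz₀, hz₀r⟩, hub⟩ := hr
  have hle : ∀ z ∈ K, ‖z‖ ≤ r := fun z hz => hub ⟨z, hz, rfl⟩
  have hz₀r : ‖z₀‖ = r := hz₀r
  have hr0 : 0 ≤ r := hz₀r ▸ norm_nonneg _
  have hr1 : r < 1 := hz₀r ▸ mem_ball_zero_iff.1 (hKdisc hz₀)
  have hbound := poissonDiam_uncertaintySet_le hc0 hr0 hr1 hle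
  refine ⟨hbound, fun hK0 => ?_⟩
  -- As `K` is nonempty, `r = 0` would force `K = {0}`.
  have hrpos : 0 < r := by
    refine hr0.lt_of_ne fun h => hK0 ?_
    have hzero : ∀ z ∈ K, z = 0 := fun z hz => norm_le_zero_iff.1 (h ▸ hle z hz)
    exact Set.eq_singleton_iff_unique_mem.2 ⟨hzero z₀ hz₀ ▸ hz₀, hzero⟩
  constructor
  · intro heq
    -- If `c 0 = 0`, semidefiniteness kills the whole sequence and any point of maximal modulus
    -- serves as `α`.
    rcases hcr.eq_or_lt with h0 | h0
    · have h0' : c 0 = 0 := Complex.ext h0.symm hci.symm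
      refine ⟨z₀, hz₀, hz₀r, fun k => ?_⟩
      rw [eq_zero_of_posSemidef_toeplitzMatrix hc h0' k, h0', zero_mul]
    · have hKc : IsCompact K :=
        Metric.isCompact_of_isClosed_isBounded hKclosed (Metric.isBounded_ball.subset hKdisc)
      exact geometric_of_le_poissonDiam h0 hKc hrpos hr1 hle heq.ge
  · rintro ⟨α, hαK, rfl, h⟩
    exact le_antisymm hbound
      (le_poissonDiam_of_geometric hc0 hαK hr1 (norm_pos_iff.1 hrpos) h)
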